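/- All graphs are finite and simple; the eigenvalues and eigenvectors of a graph are those of its adjacency matrix, an eigenvector is non-zero, and the multiplicity of an eigenvalue is the dimension of its eigenspace. $\mathfrak C(G)$ is the set of connected components of $G$, and for a set $M$ of vertex-disjoint connected subgraphs, $G/M$ is obtained from $G$ by contracting each member of $M$ to a single vertex. **Definitions.** For a tree $T$ and $\lambda\in\mathbb R$, let $N_\lambda(T)$ be the set of vertices on which every eigenvector of $T$ for $\lambda$ vanishes, and let $N^C_\lambda(T)$ be the set of vertices $v$ for which some eigenvector of $T$ for $\lambda$ vanishes at $v$ but not at some neighbour of $v$. The *skeleton* $S_\lambda(T)$ is the subgraph of $T/\mathfrak C(T\setminus N_\lambda(T))$ induced by $N^C_\lambda(T)$ together with the vertices contracted from the components of $T\setminus N_\lambda(T)$. The *meta skeleton* of $T$ for $\lambda$ is $T/\mathfrak C(T\setminus N^C_\lambda(T))$. A tree $S'$ is called a *meta skeleton with non-eigenvalue set* $X\subseteq V(S')$ if $X$ is independent; no component of $S'\setminus X$ has a perfect matching; every vertex of a component $C$ of $S'\setminus X$ that is adjacent in $S'$ to a vertex of $X$ is covered by every maximum matching of $C$; and no edge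 of $S'\setminus X$ is contained in every maximum matching of $S'\setminus X$. **Construction.** Let $S'$ be a meta skeleton with non-eigenvalue set $X\neq V(S')$ and let $\lambda\in\mathbb R$. Replace every vertex of $X$ by a tree without eigenvalue $\lambda$. Replace every vertex of $S'\setminus X$ that is missed by some maximum matching of its component of $S'\setminus X$ by a tree that has an eigenvector for $\lambda$ without zero entries. All other vertices are kept. For each edge $uv$ of $S'$, join one arbitrarily chosen vertex of the tree replacing $u$ (or $u$ itself, if it is kept) to one arbitrarily chosen vertex of the tree replacing $v$ (or $v$ itself). Let $T$ be a graph obtained in this way (whenever trees as required exist). **Theorem.** $T$ is a tree and $\lambda$ is an eigenvalue of $T$. Its multiplicity equals the number of vertices of $S'\setminus X$ missed by any maximum matching of $S'\setminus X$. Moreover, $S_\lambda(T)=S'\setminus X$ and $T/\mathfrak C(T\setminus N^C_\lambda(T))=S'$, where both equalities are graph isomorphisms that send each vertex of the left-hand graph, contracted from (or equal to) vertices of the tree that replaced a vertex $v$ of $S'$ (or equal to $v$, if $v$ was kept), to $v$. -/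

import Mathlib

universe u w

namespace TreeSkeleton

noncomputable section

/-! ### Eigenvalues and vanishing sets -/

open Classical in
/-- The adjacency matrix of `G`, as an endomorphism of `V → ℝ`. -/
def adjEnd {V : Type u} [Fintype V] (G : SimpleGraph V) : Module.End ℝ (V → ℝ) :=
  (G.adjMatrix ℝ).mulVecLin

/-- `lam` is an eigenvalue of the graph `G`. -/
def HasEigenvalue {V : Type u} [Fintype V] (G : SimpleGraph V) (lam : ℝ) : Prop :=
  Module.End.HasEigenvalue (adjEnd G) lam

/-- `x` is an eigenvector (in particular `x ≠ 0`) of `G` for the eigenvalue `lam`. -/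
def IsEigenvector {V : Type u} [Fintype V] (G : SimpleGraph V) (lam : ℝ) (x : V → ℝ) : Prop :=
  Module.End.HasEigenvector (adjEnd G) lam x

/-- The multiplicity of `lam` as an eigenvalue of `G`: the dimension of the eigenspace. -/
def multiplicity {V : Type u} [Fintype V] (G : SimpleGraph V) (lam : ℝ) : ℕ :=
  Module.finrank ℝ (Module.End.eigenspace (adjEnd G) lam)

/-- `N(G, x)`: the vertices on which `x` vanishes. -/
def zeroSet {V : Type u} (x : V → ℝ) : Set V := {v | x v = 0}

/-- `N_lam(G)`: the vertices on which every eigenvector for `lam` vanishes. -/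
def commonZeroSet {V : Type u} [Fintype V] (G : SimpleGraph V) (lam : ℝ) : Set V :=
  {v | ∀ x, IsEigenvector G lam x → v ∈ zeroSet x}

/-- `N^C(G, x)`: the vertices of `N(G, x)` adjacent to some component of `G \ N(G, x)`, that is,
to some vertex outside `N(G, x)`. -/
def boundaryZeroSet {V : Type u} (G : SimpleGraph V) (x : V → ℝ) : Set V :=
  {v | v ∈ zeroSet x ∧ ∃ w, w ∉ zeroSet x ∧ G.Adj v w}

/-- `N^C_lam(G)`: the union of the sets `N^C(G, x)` over all eigenvectors `x` for `lam`. -/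
def commonBoundaryZeroSet {V : Type u} [Fintype V] (G : SimpleGraph V) (lam : ℝ) : Set V :=
  {v | ∃ x, IsEigenvector G lam x ∧ v ∈ boundaryZeroSet G x}

/-! ### Contraction of the components of `G \ Z`, skeleton and meta skeleton of a tree -/

/-- Two vertices are identified if they are equal or lie in a common component of `G \ Z`. -/
def contractSetoid {V : Type u} (G : SimpleGraph V) (Z : Set V) : Setoid V where
  r a b := a = b ∨ ∃ (ha : a ∈ Zᶜ) (hb : b ∈ Zᶜ), (G.induce Zᶜ).Reachable ⟨a, ha⟩ ⟨b, hb⟩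
  iseqv :=
    { refl := fun _ => Or.inl rfl
      symm := by
        rintro a b (rfl | ⟨ha, hb, h⟩)
        · exact Or.inl rfl
        · exact Or.inr ⟨hb, ha, h.symm⟩
      trans := by
        rintro a b c (rfl | ⟨ha, hb, h⟩) (rfl | ⟨hb', hc, h'⟩)
        · exact Or.inl rfl
        · exact Or.inr ⟨hb', hc, h'⟩
        · exact Or.inr ⟨ha, hb, h⟩
        · exact Or.inr ⟨ha, hc, h.trans h'⟩ }

/-- The vertices of `G / 𝒞(G \ Z)`. -/
abbrev ContractVert {V : Type u} (G : SimpleGraph V) (Z : Set V) : Type u :=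
  Quotient (contractSetoid G Z)

/-- The vertex of `G / 𝒞(G \ Z)` to which a vertex of `G` is contracted. -/
def contractMk {V : Type u} (G : SimpleGraph V) (Z : Set V) (v : V) : ContractVert G Z :=
  Quotient.mk (contractSetoid G Z) v

/-- The graph `G / 𝒞(G \ Z)`, in which each component of `G \ Z` is contracted to one vertex:
distinct vertices are adjacent if some edge of `G` joins vertices contracted to them. -/
def contract {V : Type u} (G : SimpleGraph V) (Z : Set V) : SimpleGraph (ContractVert G Z) :=
  G.map (contractMk G Z)

/-- The vertex set of the skeleton in `G / 𝒞(G \ N_lam(G))`: the vertices of `N^C_lam(G)` and the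
vertices contracted from the components of `G \ N_lam(G)`. -/
def skeletonVerts {V : Type u} [Fintype V] (G : SimpleGraph V) (lam : ℝ) :
    Set (ContractVert G (commonZeroSet G lam)) :=
  contractMk G (commonZeroSet G lam) '' (commonBoundaryZeroSet G lam ∪ (commonZeroSet G lam)ᶜ)

/-- The skeleton `S_lam(G)`. -/
def skeleton {V : Type u} [Fintype V] (G : SimpleGraph V) (lam : ℝ) :
    SimpleGraph (skeletonVerts G lam) :=
  (contract G (commonZeroSet G lam)).induce (skeletonVerts G lam)

/-- The meta skeleton `G / 𝒞(G \ N^C_lam(G))`. -/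
def metaSkeleton {V : Type u} [Fintype V] (G : SimpleGraph V) (lam : ℝ) :
    SimpleGraph (ContractVert G (commonBoundaryZeroSet G lam)) :=
  contract G (commonBoundaryZeroSet G lam)

/-! ### Maximum matchings and abstract meta skeletons -/

/-- `M` is a matching of `G` with the greatest possible number of edges. -/
def IsMaximumMatching {V : Type u} {G : SimpleGraph V} (M : G.Subgraph) : Prop :=
  M.IsMatching ∧ ∀ M' : G.Subgraph, M'.IsMatching → M'.edgeSet.ncard ≤ M.edgeSet.ncard

/-- `v` may be missed by a maximum matching of `G`. -/
def MayBeMissed {V : Type u} (G : SimpleGraph V) (v : V) : Prop :=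
  ∃ M : G.Subgraph, IsMaximumMatching M ∧ v ∉ M.verts

/-- `v` may be missed by a maximum matching of the component of `G` that contains it. -/
def MayBeMissedInComponent {V : Type u} (G : SimpleGraph V) (v : V) : Prop :=
  MayBeMissed (G.connectedComponentMk v).toSimpleGraph
    ⟨v, SimpleGraph.ConnectedComponent.connectedComponentMk_mem⟩

/-- `S` is a meta skeleton with admissible non-eigenvalue set `X`. -/
structure IsMetaSkeleton {V : Type u} (S : SimpleGraph V) (X : Set V) : Prop where
  isTree : S.IsTree
  isIndepSet : S.IsIndepSet X
  no_perfect_matching : ∀ C : (S.induce Xᶜ).ConnectedComponent,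
    ∀ M : C.toSimpleGraph.Subgraph, ¬ M.IsPerfectMatching
  /-- Only vertices contained in every maximum matching of their component are adjacent to `X`. -/
  adj_not_missed : ∀ (c : ↥Xᶜ) (x : V), x ∈ X → S.Adj c x →
    ¬ MayBeMissedInComponent (S.induce Xᶜ) c
  no_edge_in_all : ∀ e ∈ (S.induce Xᶜ).edgeSet,
    ∃ M : (S.induce Xᶜ).Subgraph, IsMaximumMatching M ∧ e ∉ M.edgeSet

/-- `v` lies outside `X` and may be missed by a maximum matching of its component of `S \ X`. -/
def IsMissable {V : Type u} (S : SimpleGraph V) (X : Set V) (v : V) : Prop :=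
  ∃ hv : v ∈ Xᶜ, MayBeMissedInComponent (S.induce Xᶜ) ⟨v, hv⟩

/-! ### Blowing up -/

/-- The choices made when blowing up `S` with non-eigenvalue set `X` for the number `lam`. Every
vertex `v` receives a tree `part v`: one without eigenvalue `lam` if `v ∈ X`, one with a nowhere
vanishing eigenvector for `lam` if `v` is missable, and a single vertex (`v` is not substituted)
otherwise. For an edge `uv` of `S`, `attach u v` is the vertex of `part u` chosen as its end (the
values of `attach` on non-adjacent pairs are not used). -/
structure BlowUp {V : Type u} (S : SimpleGraph V) (X : Set V) (lam : ℝ) where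
  Part : V → Type w
  [fintypePart : ∀ v, Fintype (Part v)]
  part : ∀ v, SimpleGraph (Part v)
  part_isTree : ∀ v, (part v).IsTree
  part_of_mem : ∀ v ∈ X, ¬ HasEigenvalue (part v) lam
  part_of_missable : ∀ v, IsMissable S X v →
    ∃ y : Part v → ℝ, IsEigenvector (part v) lam y ∧ ∀ a, y a ≠ 0
  part_of_other : ∀ v, v ∉ X → ¬ IsMissable S X v → Subsingleton (Part v)
  attach : ∀ u : V, V → Part u

namespace BlowUp

variable {V : Type u} {S : SimpleGraph V} {X : Set V} {lam : ℝ}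

instance instFintypePart (B : BlowUp.{u, w} S X lam) (v : V) : Fintype (B.Part v) :=
  B.fintypePart v

/-- The vertices of the blown-up graph. -/
abbrev Vert (B : BlowUp.{u, w} S X lam) : Type (max u w) := Σ v, B.Part v

/-- Adjacency in the blown-up graph: the edges of the substituted trees, and for each edge of `S`
one edge between the chosen end vertices. -/
inductive Adj (B : BlowUp.{u, w} S X lam) : B.Vert → B.Vert → Prop
  | inner {v : V} {a b : B.Part v} (h : (B.part v).Adj a b) : Adj B ⟨v, a⟩ ⟨v, b⟩
  | link {u v : V} (h : S.Adj u v) : Adj B ⟨u, B.attach u v⟩ ⟨v, B.attach v u⟩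

/-- The blown-up graph. -/
def graph (B : BlowUp.{u, w} S X lam) : SimpleGraph B.Vert where
  Adj := B.Adj
  symm := ⟨by
    rintro _ _ (h | h)
    · exact Adj.inner h.symm
    · exact Adj.link h.symm⟩
  loopless := ⟨by
    rintro ⟨v, a⟩ h
    have key : ∀ p q : B.Vert, B.Adj p q → p ≠ q := by
      rintro _ _ (h | h) hpq
      · exact h.ne (eq_of_heq (Sigma.mk.inj_iff.1 hpq).2)
      · exact h.ne (congrArg Sigma.fst hpq)
    exact key _ _ h rfl⟩

end BlowUp

end

end TreeSkeleton

namespace TreeSkeleton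

noncomputable section

/-! Call a vertex outside `X` core if it is not missable. In a forest, two missable vertices are
never adjacent (`not_adj_of_mayBeMissed`). As no edge lies in every maximum matching, every maximum
matching pairs each core vertex with a missable one (`mayBeMissed_partner`). With the conditions on
`X`, all neighbours of non-core vertices are core (`isCore_of_adj`), and core vertices are not blown
up.

Let `W` be the `linkMatrix`, with missable rows and core columns: its entries over edges of `S` are
values of nowhere vanishing eigenvectors, all others are zero. Pairing the eigenvalue equation on a
missable part with the chosen eigenvector of that part shows that the core values `t` of an
eigenvector satisfy `W t = 0`. Since `W` is supported on a forest and a matching covers its columns,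
`t = 0` (`eq_zero_of_mulVec_matching`). The parts then decouple: the eigenvector vanishes over `X`
and is a multiple of the chosen eigenvector on each missable part. The remaining equations, those at
the core, say that the row vector `c` of multiples satisfies `c W = 0`.

Hence the multiplicity is the number of missable vertices minus the number of core vertices, which
is the number of vertices missed by a maximum matching. A matching that misses `d` yields a solution
`c` with nonzero entry at `d` (`exists_coeff_ne_zero`). So the common zero set is everything outside
the missable parts, its boundary is the core, and both contractions can be read off. -/

/-! ### Cuts of acyclic graphs -/

/-- The vertices that can be reached from `v` without using the edge `uv`. -/
def farSide {V : Type u} (G : SimpleGraph V) (u v : V) : Set V :=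
  {w | (G.deleteEdges {s(u, v)}).Reachable v w}

lemma mem_farSide_self {V : Type u} (G : SimpleGraph V) (u v : V) : v ∈ farSide G u v :=
  SimpleGraph.Reachable.refl _

lemma farSide_closed {V : Type u} {G : SimpleGraph V} {u v a b : V} (hab : G.Adj a b)
    (hne : s(a, b) ≠ s(u, v)) (ha : a ∈ farSide G u v) : b ∈ farSide G u v := by
  refine SimpleGraph.Reachable.trans ha (SimpleGraph.Adj.reachable ?_)
  rw [SimpleGraph.deleteEdges_adj]
  exact ⟨hab, by simpa using hne⟩

lemma notMem_farSide {V : Type u} {G : SimpleGraph V} (hG : G.IsAcyclic) {u v : V}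
    (h : G.Adj u v) : u ∉ farSide G u v := by
  have h1 := SimpleGraph.isAcyclic_iff_forall_adj_isBridge.1 hG h
  rw [SimpleGraph.isBridge_iff] at h1
  exact fun h2 => h1 (SimpleGraph.Reachable.symm h2)

lemma eq_of_adj_of_mem_farSide {V : Type u} {G : SimpleGraph V} (hG : G.IsAcyclic) {u v : V}
    (h : G.Adj u v) {a b : V} (hab : G.Adj a b) (ha : a ∈ farSide G u v)
    (hb : b ∉ farSide G u v) : a = v ∧ b = u := by
  by_cases he : s(a, b) = s(u, v)
  · rcases Sym2.eq_iff.1 he with ⟨rfl, rfl⟩ | ⟨rfl, rfl⟩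
    · exact absurd ha (notMem_farSide hG h)
    · exact ⟨rfl, rfl⟩
  · exact absurd (farSide_closed hab he ha) hb

/-! ### Matchings as involutions -/

/-- The involution `m` moves vertices along edges of `G` only, so it encodes the matching
formed by the edges from `v` to `m v ≠ v`. -/
structure IsMatchingMap {V : Type u} (G : SimpleGraph V) (m : V → V) : Prop where
  invol : ∀ v, m (m v) = v
  adj : ∀ v, m v ≠ v → G.Adj v (m v)

/-- The number of fixed points of `m` in `U`. -/
def fixCount {V : Type u} (U : Set V) (m : V → V) : ℕ := {v | v ∈ U ∧ m v = v}.ncard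

/-- A matching with the least number of uncovered vertices. -/
structure IsMaxMatchingMap {V : Type u} (G : SimpleGraph V) (m : V → V) : Prop
    extends IsMatchingMap G m where
  le : ∀ n, IsMatchingMap G n → fixCount Set.univ m ≤ fixCount Set.univ n

section

variable {V : Type u} {G : SimpleGraph V}

lemma isMatchingMap_id : IsMatchingMap G id := ⟨fun _ => rfl, fun _ h => (h rfl).elim⟩

open Classical in
/-- The map that agrees with `m` on `U` and with `n` outside `U`. -/
def splice (U : Set V) (m n : V → V) (v : V) : V := if v ∈ U then m v else n v

lemma splice_of_mem {U : Set V} {m n : V → V} {v : V} (h : v ∈ U) : splice U m n v = m v :=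
  if_pos h

lemma splice_of_notMem {U : Set V} {m n : V → V} {v : V} (h : v ∉ U) : splice U m n v = n v :=
  if_neg h

lemma IsMatchingMap.mem_of_mapsTo {m : V → V} (hm : IsMatchingMap G m) {U : Set V}
    (h : ∀ v ∈ U, m v ∈ U) {v : V} (hv : v ∉ U) : m v ∉ U := fun h' => by
  have := h _ h'
  rw [hm.invol] at this
  exact hv this

lemma IsMatchingMap.splice {m n : V → V} (hm : IsMatchingMap G m) (hn : IsMatchingMap G n)
    {U : Set V} (hmU : ∀ v ∈ U, m v ∈ U) (hnU : ∀ v ∈ U, n v ∈ U) :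
    IsMatchingMap G (splice U m n) := by
  refine ⟨fun v => ?_, fun v => ?_⟩
  · by_cases hv : v ∈ U
    · rw [splice_of_mem hv, splice_of_mem (hmU v hv), hm.invol]
    · rw [splice_of_notMem hv, splice_of_notMem (hn.mem_of_mapsTo hnU hv), hn.invol]
  · by_cases hv : v ∈ U
    · rw [splice_of_mem hv]; exact hm.adj v
    · rw [splice_of_notMem hv]; exact hn.adj v

/-- Removing the edge `v (m v)` from a matching. -/
lemma IsMatchingMap.remove {m : V → V} (hm : IsMatchingMap G m) (a : V) :
    IsMatchingMap G (TreeSkeleton.splice {a, m a} id m) := by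
  have h : ∀ v ∈ ({a, m a} : Set V), m v ∈ ({a, m a} : Set V) := by
    rintro v (rfl | rfl)
    · exact Or.inr rfl
    · rw [hm.invol]; exact Or.inl rfl
  exact isMatchingMap_id.splice hm (fun v hv => hv) h

open Classical in
/-- Adding an edge between two uncovered vertices. -/
lemma IsMatchingMap.add {m : V → V} (hm : IsMatchingMap G m) {a b : V} (hab : G.Adj a b)
    (ha : m a = a) (hb : m b = b) :
    IsMatchingMap G (TreeSkeleton.splice {a, b} (Equiv.swap a b) m) := by
  have hs : ∀ v, v ∉ ({a, b} : Set V) → Equiv.swap a b v = v := fun v hv =>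
    Equiv.swap_apply_of_ne_of_ne (fun h => hv (Or.inl h)) (fun h => hv (Or.inr h))
  have hswap : IsMatchingMap G (Equiv.swap a b) := by
    refine ⟨fun v => by simp, fun v hv => ?_⟩
    by_cases h : v ∈ ({a, b} : Set V)
    · rcases h with rfl | rfl
      · simpa using hab
      · simpa using hab.symm
    · exact absurd (hs v h) hv
  refine hswap.splice hm ?_ ?_
  · rintro v (rfl | rfl) <;> simp
  · rintro v (rfl | rfl)
    · rw [ha]; exact Or.inl rfl
    · rw [hb]; exact Or.inr rfl

lemma fixCount_congr {U : Set V} {m n : V → V} (h : ∀ v ∈ U, m v = n v) :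
    fixCount U m = fixCount U n := by
  unfold fixCount
  congr 1
  ext v
  constructor <;> rintro ⟨h1, h2⟩
  · exact ⟨h1, by rw [← h v h1, h2]⟩
  · exact ⟨h1, by rw [h v h1, h2]⟩

lemma exists_isMaxMatchingMap (G : SimpleGraph V) : ∃ m, IsMaxMatchingMap G m := by
  classical
  have h : ∃ k, ∃ m, IsMatchingMap G m ∧ fixCount Set.univ m = k := ⟨_, id, isMatchingMap_id, rfl⟩
  obtain ⟨m, hm, hk⟩ := Nat.find_spec h
  exact ⟨m, hm, fun n hn => hk ▸ Nat.find_min' h ⟨n, hn, rfl⟩⟩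

/-! ### Comparison with subgraphs -/

/-- `m` moves exactly the vertices of `M`, along the edges of `M`. -/
def Encodes (M : G.Subgraph) (m : V → V) : Prop :=
  (∀ v w, M.Adj v w ↔ m v = w ∧ v ≠ w) ∧ ∀ v, v ∈ M.verts ↔ m v ≠ v

lemma exists_encodes {M : G.Subgraph} (hM : M.IsMatching) :
    ∃ m, IsMatchingMap G m ∧ Encodes M m := by
  classical
  choose f hf hf' using fun v (hv : v ∈ M.verts) => hM hv
  let m : V → V := fun v => if hv : v ∈ M.verts then f v hv else v
  have hm : ∀ v w, M.Adj v w → m v = w := fun v w h => by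
    have hv := M.edge_vert h
    simp only [m, dif_pos hv]
    exact (hf' v hv w h).symm
  have hm' : ∀ v ∈ M.verts, M.Adj v (m v) := fun v hv => by
    simp only [m, dif_pos hv]
    exact hf v hv
  have hm'' : ∀ v, m v ≠ v → v ∈ M.verts := fun v h => by
    by_contra hv
    exact h (by simp only [m, dif_neg hv])
  refine ⟨m, ⟨fun v => ?_, fun v hv => (hm' v (hm'' v hv)).adj_sub⟩, fun v w => ?_, fun v => ?_⟩
  · by_cases hv : m v = v
    · rw [hv, hv]
    · exact hm _ _ (hm' v (hm'' v hv)).symm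
  · refine ⟨fun h => ⟨hm v w h, h.ne⟩, ?_⟩
    rintro ⟨rfl, h⟩
    exact hm' v (hm'' v h.symm)
  · exact ⟨fun hv => (hm' v hv).ne.symm, hm'' v⟩

lemma IsMatchingMap.exists_subgraph {m : V → V} (hm : IsMatchingMap G m) :
    ∃ M : G.Subgraph, M.IsMatching ∧ Encodes M m := by
  refine ⟨{ verts := {v | m v ≠ v}
            Adj := fun v w => m v = w ∧ v ≠ w
            adj_sub := ?_
            edge_vert := ?_
            symm := ?_ }, ?_, fun _ _ => Iff.rfl, fun _ => Iff.rfl⟩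
  · rintro v w ⟨rfl, h⟩
    exact hm.adj v h.symm
  · rintro v w ⟨rfl, h⟩
    exact h.symm
  · refine ⟨?_⟩
    rintro v w ⟨rfl, h⟩
    exact ⟨hm.invol v, h.symm⟩
  · intro v hv
    exact ⟨m v, ⟨rfl, fun h => hv h.symm⟩, fun w h => h.1.symm⟩

lemma Encodes.compl_verts_ncard {M : G.Subgraph} {m : V → V} (h : Encodes M m) :
    M.vertsᶜ.ncard = fixCount Set.univ m := by
  unfold fixCount
  congr 1
  ext v
  simp [h.2]

lemma fixCount_subtype (U : Set V) (n : U → U) (m : V → V) (h : ∀ v : U, m v = n v) :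
    fixCount Set.univ n = fixCount U m := by
  unfold fixCount
  rw [← Set.ncard_image_of_injective _ Subtype.coe_injective]
  congr 1
  ext v
  constructor
  · rintro ⟨w, ⟨-, hw⟩, rfl⟩
    exact ⟨w.2, by rw [h, hw]⟩
  · rintro ⟨hv, hm⟩
    exact ⟨⟨v, hv⟩, ⟨trivial, Subtype.ext (by rw [← h]; exact hm)⟩, rfl⟩

open Classical in
/-- The extension of a map on `U` by the identity. -/
def extendMap (U : Set V) (n : U → U) (v : V) : V := if hv : v ∈ U then n ⟨v, hv⟩ else v

lemma extendMap_coe (U : Set V) (n : U → U) (v : U) : extendMap U n v = n v := by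
  simp [extendMap]

lemma extendMap_mem (U : Set V) (n : U → U) (v : V) (hv : v ∈ U) : extendMap U n v ∈ U := by
  simp [extendMap, hv]

lemma IsMatchingMap.extendMap {U : Set V} {n : U → U} (hn : IsMatchingMap (G.induce U) n) :
    IsMatchingMap G (extendMap U n) := by
  refine ⟨fun v => ?_, fun v hv => ?_⟩
  · by_cases h : v ∈ U
    · rw [extendMap_coe U n ⟨v, h⟩, extendMap_coe, hn.invol]
    · simp [TreeSkeleton.extendMap, h]
  · by_cases h : v ∈ U
    · have h1 := extendMap_coe U n ⟨v, h⟩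
      rw [h1] at hv ⊢
      exact hn.adj ⟨v, h⟩ fun h' => hv (by rw [h'])
    · simp [TreeSkeleton.extendMap, h] at hv

lemma IsMatchingMap.restrict {U : Set V} {m : V → V} (hm : IsMatchingMap G m)
    (h : ∀ v ∈ U, m v ∈ U) : IsMatchingMap (G.induce U) fun v => ⟨m v, h v v.2⟩ :=
  ⟨fun v => Subtype.ext (hm.invol v), fun v hv => hm.adj v fun h' => hv (Subtype.ext h')⟩

/-- A matching that does not contain the edge `uv` of a forest preserves the two sides of `uv`. -/
lemma IsMatchingMap.mapsTo_farSide (hG : G.IsAcyclic) {m : V → V} (hm : IsMatchingMap G m)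
    {u v : V} (h : G.Adj u v) (hne : m v ≠ u) : ∀ w ∈ farSide G u v, m w ∈ farSide G u v := by
  intro w hw
  by_contra hmw
  have hw' : m w ≠ w := fun h' => hmw (by rwa [h'])
  obtain ⟨rfl, h2⟩ := eq_of_adj_of_mem_farSide hG h (hm.adj w hw') hw hmw
  exact hne h2

variable [Fintype V]

lemma fixCount_add_compl (U : Set V) (m : V → V) :
    fixCount U m + fixCount Uᶜ m = fixCount Set.univ m := by
  unfold fixCount
  rw [← Set.ncard_union_eq (Set.disjoint_left.2 fun v h h' => h'.1 h.1)]
  congr 1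
  ext v
  simp only [Set.mem_union, Set.mem_ofPred_eq, Set.mem_univ, true_and, Set.mem_compl_iff]
  tauto

lemma fixCount_splice (U : Set V) (m n : V → V) :
    fixCount Set.univ (splice U m n) = fixCount U m + fixCount Uᶜ n := by
  rw [← fixCount_add_compl U, fixCount_congr (fun v hv => splice_of_mem hv),
    fixCount_congr (U := Uᶜ) (fun v hv => splice_of_notMem hv)]

lemma two_mul_ncard_edgeSet {M : G.Subgraph} (hM : M.IsMatching) :
    2 * M.edgeSet.ncard = M.verts.ncard := by
  classical
  have h1 : _ = ∑ _v : M.verts, 1 :=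
    M.coe.sum_degrees_eq_twice_card_edges.symm.trans (Finset.sum_congr rfl fun v _ => by
      rw [SimpleGraph.Subgraph.coe_degree]
      convert (SimpleGraph.Subgraph.isMatching_iff_forall_degree.1 hM) v v.2)
  have h3 : M.edgeSet.ncard = M.coe.edgeFinset.card := by
    rw [← SimpleGraph.Subgraph.image_coe_edgeSet_coe,
      Set.ncard_image_of_injective _ (Sym2.map.injective Subtype.coe_injective),
      ← SimpleGraph.coe_edgeFinset, Set.ncard_coe_finset]
  rw [h3, h1]
  simp [Set.ncard_eq_toFinset_card']

/-- This turns maximising edges into minimising fixed points, and it fixes the parity of the number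
of fixed points. -/
lemma Encodes.card {M : G.Subgraph} (hM : M.IsMatching) {m : V → V} (h : Encodes M m) :
    2 * M.edgeSet.ncard + fixCount Set.univ m = Fintype.card V := by
  rw [two_mul_ncard_edgeSet hM, ← h.compl_verts_ncard, Set.ncard_add_ncard_compl,
    Nat.card_eq_fintype_card]

lemma IsMatchingMap.exists_two_mul_add {m : V → V} (hm : IsMatchingMap G m) :
    ∃ k, 2 * k + fixCount Set.univ m = Fintype.card V := by
  obtain ⟨M, hM, h⟩ := hm.exists_subgraph
  exact ⟨_, h.card hM⟩

lemma Encodes.isMaximumMatching_iff {M : G.Subgraph} (hM : M.IsMatching) {m : V → V}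
    (hm : IsMatchingMap G m) (h : Encodes M m) :
    IsMaximumMatching M ↔ IsMaxMatchingMap G m := by
  have hc := h.card hM
  constructor
  · rintro ⟨-, h1⟩
    refine ⟨hm, fun n hn => ?_⟩
    obtain ⟨N, hN, hNn⟩ := hn.exists_subgraph
    have := h1 N hN
    have := hNn.card hN
    omega
  · intro h1
    refine ⟨hM, fun N hN => ?_⟩
    obtain ⟨n, hn, hNn⟩ := exists_encodes hN
    have := h1.le n hn
    have := hNn.card hN
    omega

lemma mayBeMissed_iff {v : V} : MayBeMissed G v ↔ ∃ m, IsMaxMatchingMap G m ∧ m v = v := by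
  constructor
  · rintro ⟨M, hM, hv⟩
    obtain ⟨m, hm, h⟩ := exists_encodes hM.1
    exact ⟨m, (h.isMaximumMatching_iff hM.1 hm).1 hM, not_not.1 fun h' => hv ((h.2 v).2 h')⟩
  · rintro ⟨m, hm, hv⟩
    obtain ⟨M, hM, h⟩ := hm.toIsMatchingMap.exists_subgraph
    exact ⟨M, (h.isMaximumMatching_iff hM hm.toIsMatchingMap).2 hm, fun h' => (h.2 v).1 h' hv⟩

/-! ### Missable vertices of components -/

/-- If no edge leaves `U`, then maximum matchings can be combined from those on `U` and `Uᶜ`. -/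
lemma mayBeMissed_induce_iff (U : Set V) (hU : ∀ a ∈ U, ∀ b, G.Adj a b → b ∈ U) (v : U) :
    MayBeMissed (G.induce U) v ↔ MayBeMissed G (v : V) := by
  classical
  have hpres : ∀ m, IsMatchingMap G m → ∀ v ∈ U, m v ∈ U := fun m hm v hv => by
    by_cases h : m v = v
    · rwa [h]
    · exact hU v hv _ (hm.adj v h)
  rw [mayBeMissed_iff, mayBeMissed_iff]
  constructor
  · rintro ⟨n, hn, hv⟩
    obtain ⟨m, hm⟩ := exists_isMaxMatchingMap G
    have hs := hn.toIsMatchingMap.extendMap.splice hm.toIsMatchingMap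
      (extendMap_mem U n) (hpres m hm.toIsMatchingMap)
    refine ⟨splice U (extendMap U n) m, ⟨hs, fun k hk => ?_⟩, ?_⟩
    · refine le_trans ?_ (hm.le k hk)
      rw [fixCount_splice, ← fixCount_add_compl U m]
      have h1 := hn.le _ (hm.toIsMatchingMap.restrict (hpres m hm.toIsMatchingMap))
      rw [fixCount_subtype U n _ (extendMap_coe U n), fixCount_subtype U _ m (fun _ => rfl)] at h1
      omega
    · rw [splice_of_mem v.2, extendMap_coe, hv]
  · rintro ⟨m, hm, hv⟩
    refine ⟨_, ⟨hm.toIsMatchingMap.restrict (hpres m hm.toIsMatchingMap), fun k hk => ?_⟩,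
      Subtype.ext hv⟩
    have hs := hk.extendMap.splice hm.toIsMatchingMap
      (extendMap_mem U k) (hpres m hm.toIsMatchingMap)
    have h1 := hm.le _ hs
    rw [fixCount_splice, ← fixCount_add_compl U m] at h1
    rw [fixCount_subtype U k _ (extendMap_coe U k), fixCount_subtype U _ m (fun _ => rfl)]
    omega

/-- No edge leaves a component, so maximality can be tested componentwise. -/
lemma mayBeMissedInComponent_iff (v : V) : MayBeMissedInComponent G v ↔ MayBeMissed G v := by
  refine mayBeMissed_induce_iff (G.connectedComponentMk v).supp ?_ ⟨v, _⟩
  intro a ha b hab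
  rw [SimpleGraph.ConnectedComponent.mem_supp_iff] at ha ⊢
  rw [← ha]
  exact (SimpleGraph.ConnectedComponent.connectedComponentMk_eq_of_adj hab).symm

/-! ### Missable vertices of forests -/

/-- If `m` misses `u` and `n` misses `v`, neither uses the edge `uv`, so they can be exchanged
across it. One of the two exchanged matchings misses both ends and is still maximum, yet `uv` could
be added to it. -/
lemma not_adj_of_mayBeMissed (hG : G.IsAcyclic) {u v : V} (hu : MayBeMissed G u)
    (hv : MayBeMissed G v) : ¬ G.Adj u v := by
  classical
  intro h
  obtain ⟨m, hm, hmu⟩ := mayBeMissed_iff.1 hu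
  obtain ⟨n, hn, hnv⟩ := mayBeMissed_iff.1 hv
  have hmU := hm.toIsMatchingMap.mapsTo_farSide hG h fun h' => h.ne (by
    have := hm.invol v
    rw [h', hmu] at this
    exact this)
  have hnU := hn.toIsMatchingMap.mapsTo_farSide hG h (by rw [hnv]; exact h.ne.symm)
  have h1 := hn.toIsMatchingMap.splice hm.toIsMatchingMap hnU hmU
  have h2 := hm.toIsMatchingMap.splice hn.toIsMatchingMap hmU hnU
  have c1 := fixCount_splice (farSide G u v) n m
  have c2 := fixCount_splice (farSide G u v) m n
  have c3 := fixCount_add_compl (farSide G u v) m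
  have c4 := fixCount_add_compl (farSide G u v) n
  have c5 := hn.le _ h2
  have c6 := hm.le _ hn.toIsMatchingMap
  have hsu : splice (farSide G u v) n m u = u := by
    rw [splice_of_notMem (notMem_farSide hG h), hmu]
  have hsv : splice (farSide G u v) n m v = v := by
    rw [splice_of_mem (mem_farSide_self G u v), hnv]
  have h3 := h1.add h hsu hsv
  have c7 := hm.le _ h3
  have c8 : fixCount {u, v} (Equiv.swap u v) = 0 := by
    rw [fixCount, Set.ncard_eq_zero, Set.eq_empty_iff_forall_notMem]
    rintro w ⟨rfl | rfl, hw⟩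
    · simp only [Equiv.swap_apply_left] at hw; exact h.ne hw.symm
    · simp only [Equiv.swap_apply_right] at hw; exact h.ne hw
  have c9 : 0 < fixCount {u, v} (splice (farSide G u v) n m) := by
    rw [fixCount, Set.ncard_pos]
    exact ⟨u, Or.inl rfl, hsu⟩
  have c10 := fixCount_add_compl {u, v} (splice (farSide G u v) n m)
  rw [fixCount_splice] at c7
  omega

/-- Remove the edge from `a` to `b = m a` from `m` and exchange the result with `n` across that
edge. The two exchanged matchings have together two more fixed points than two maximum matchings, so
by parity one of them is maximum. The one missing `a` cannot be, so the one missing `b` is. -/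
lemma mayBeMissed_partner (hG : G.IsAcyclic) {m n : V → V} (hm : IsMaxMatchingMap G m)
    (hn : IsMaxMatchingMap G n) {a : V} (ha : ¬ MayBeMissed G a) (hna : n a ≠ m a) :
    MayBeMissed G (m a) := by
  classical
  have hma : m a ≠ a := fun h => ha (mayBeMissed_iff.2 ⟨m, hm, h⟩)
  have h := hm.adj a hma
  set b := m a with hb
  set U := farSide G a b with hUdef
  have hbU : b ∈ U := mem_farSide_self G a b
  have haU : a ∉ U := notMem_farSide hG h
  have hmb : m b = a := hm.invol a
  have hnU : ∀ w ∈ U, n w ∈ U :=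
    hn.toIsMatchingMap.mapsTo_farSide hG h fun h' => hna (by rw [← h', hn.invol])
  have hr := hm.toIsMatchingMap.remove a
  rw [← hb] at hr
  have hra : splice {a, b} id m a = a := splice_of_mem (Or.inl rfl)
  have hrb : splice {a, b} id m b = b := splice_of_mem (Or.inr rfl)
  have hrU : ∀ w ∈ U, splice {a, b} id m w ∈ U :=
    hr.mapsTo_farSide hG h (by rw [hrb]; exact h.ne.symm)
  have h1 := hn.toIsMatchingMap.splice hr hnU hrU
  have h2 := hr.splice hn.toIsMatchingMap hrU hnU
  have c1 := fixCount_splice U n (splice {a, b} id m)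
  have c2 := fixCount_splice U (splice {a, b} id m) n
  have c3 := fixCount_add_compl U n
  have c4 := fixCount_add_compl U (splice {a, b} id m)
  have c5 := fixCount_splice {a, b} id m
  have c6 := fixCount_add_compl {a, b} m
  have c7 : fixCount {a, b} (id : V → V) = 2 := by
    have : {v | v ∈ ({a, b} : Set V) ∧ id v = v} = {a, b} := by
      ext v; simp
    rw [fixCount, this, Set.ncard_pair h.ne]
  have c8 : fixCount {a, b} m = 0 := by
    rw [fixCount, Set.ncard_eq_zero, Set.eq_empty_iff_forall_notMem]
    rintro w ⟨rfl | rfl, hw⟩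
    · exact hma hw
    · rw [hmb] at hw; exact h.ne hw
  have c9 := hm.le _ hn.toIsMatchingMap
  have c10 := hn.le _ hm.toIsMatchingMap
  have c11 := hm.le _ h1
  have c12 := hm.le _ h2
  obtain ⟨k1, hk1⟩ := hm.toIsMatchingMap.exists_two_mul_add
  obtain ⟨k2, hk2⟩ := h1.exists_two_mul_add
  obtain ⟨k3, hk3⟩ := h2.exists_two_mul_add
  have : fixCount Set.univ (splice U n (splice {a, b} id m)) = fixCount Set.univ m ∨
      fixCount Set.univ (splice U (splice {a, b} id m) n) = fixCount Set.univ m := by omega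
  rcases this with h3 | h3
  · refine absurd (mayBeMissed_iff.2 ⟨_, ⟨h1, fun k hk => ?_⟩, ?_⟩) ha
    · rw [h3]; exact hm.le k hk
    · rw [splice_of_notMem haU, hra]
  · refine mayBeMissed_iff.2 ⟨_, ⟨h2, fun k hk => ?_⟩, ?_⟩
    · rw [h3]; exact hm.le k hk
    · rw [splice_of_mem hbU, hrb]

end

/-! ### Missable and core vertices of a meta skeleton -/

/-- `v` lies outside `X` and is covered by every maximum matching of its component. -/
def IsCore {V : Type u} (S : SimpleGraph V) (X : Set V) (v : V) : Prop :=
  v ∉ X ∧ ¬ IsMissable S X v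

section

variable {V : Type u} {S : SimpleGraph V} {X : Set V}

lemma IsMetaSkeleton.isAcyclic_induce (hS : IsMetaSkeleton S X) : (S.induce Xᶜ).IsAcyclic :=
  hS.isTree.isAcyclic.induce _

lemma IsMetaSkeleton.not_adj_of_mem (hS : IsMetaSkeleton S X) {u v : V}
    (hu : IsMissable S X u) (hv : v ∈ X) : ¬ S.Adj u v := by
  obtain ⟨hu', hu⟩ := hu
  exact fun h => hS.adj_not_missed ⟨u, hu'⟩ v hv h hu

variable [Fintype V]

lemma isMissable_iff {v : V} :
    IsMissable S X v ↔ ∃ hv : v ∈ Xᶜ, MayBeMissed (S.induce Xᶜ) ⟨v, hv⟩ := by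
  classical
  simp only [IsMissable, mayBeMissedInComponent_iff]

lemma isMissable_coe_iff {v : ↥Xᶜ} : IsMissable S X v ↔ MayBeMissed (S.induce Xᶜ) v := by
  rw [isMissable_iff]
  exact ⟨fun ⟨_, h⟩ => h, fun h => ⟨v.2, h⟩⟩

lemma IsMetaSkeleton.not_adj_missable (hS : IsMetaSkeleton S X) {u v : V}
    (hu : IsMissable S X u) (hv : IsMissable S X v) : ¬ S.Adj u v := by
  classical
  obtain ⟨hu', hu⟩ := isMissable_iff.1 hu
  obtain ⟨hv', hv⟩ := isMissable_iff.1 hv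
  exact fun h => not_adj_of_mayBeMissed hS.isAcyclic_induce hu hv h

/-- The non-core vertices, in `X` or missable, form an independent set; this decouples the parts
once the core values vanish. -/
lemma IsMetaSkeleton.isCore_of_adj (hS : IsMetaSkeleton S X) {u v : V}
    (hu : ¬ IsCore S X u) (h : S.Adj u v) : IsCore S X v := by
  have hu' : u ∈ X ∨ IsMissable S X u := by
    by_contra! h'
    exact hu h'
  rcases hu' with hu' | hu'
  · refine ⟨fun hv => hS.isIndepSet hu' hv h.ne h, fun hv => hS.not_adj_of_mem hv hu' h.symm⟩
  · exact ⟨fun hv => hS.not_adj_of_mem hu' hv h, fun hv => hS.not_adj_missable hu' hv h⟩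

lemma IsMetaSkeleton.isMissable_partner (hS : IsMetaSkeleton S X) {m : ↥Xᶜ → ↥Xᶜ}
    (hm : IsMaxMatchingMap (S.induce Xᶜ) m) {a : ↥Xᶜ} (ha : ¬ IsMissable S X a) :
    IsMissable S X (m a) := by
  classical
  rw [isMissable_coe_iff] at ha ⊢
  have hma : m a ≠ a := fun h => ha (mayBeMissed_iff.2 ⟨m, hm, h⟩)
  obtain ⟨N, hN, he⟩ := hS.no_edge_in_all s(a, m a) (hm.adj a hma)
  obtain ⟨n, hn, hNn⟩ := exists_encodes hN.1
  refine mayBeMissed_partner hS.isAcyclic_induce hm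
    ((hNn.isMaximumMatching_iff hN.1 hn).1 hN) ha fun h => he ?_
  exact (hNn.1 a (m a)).2 ⟨h, hma.symm⟩

lemma IsMetaSkeleton.exists_isMissable (hS : IsMetaSkeleton S X) (hX : X ≠ Set.univ) :
    ∃ v, IsMissable S X v := by
  classical
  obtain ⟨v, hv⟩ := (Set.ne_univ_iff_exists_notMem X).1 hX
  by_cases h : IsMissable S X v
  · exact ⟨v, h⟩
  · obtain ⟨m, hm⟩ := exists_isMaxMatchingMap (S.induce Xᶜ)
    exact ⟨_, hS.isMissable_partner hm (a := ⟨v, hv⟩) h⟩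

/-- The core can be matched into the missable vertices other than a given one. -/
lemma IsMetaSkeleton.exists_matching_avoiding (hS : IsMetaSkeleton S X) {d : V}
    (hd : IsMissable S X d) : ∃ f : {v // IsCore S X v} → {v // IsMissable S X v},
      Function.Injective f ∧ (∀ a, S.Adj (f a) a) ∧ ∀ a, (f a : V) ≠ d := by
  classical
  obtain ⟨hd', hd⟩ := isMissable_iff.1 hd
  obtain ⟨m, hm, hmd⟩ := mayBeMissed_iff.1 hd
  refine ⟨fun a => ⟨m ⟨a, a.2.1⟩, hS.isMissable_partner hm a.2.2⟩, ?_, ?_, ?_⟩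
  · intro a b hab
    have h0 := congrArg Subtype.val hab
    have h1 : m ⟨a, a.2.1⟩ = m ⟨b, b.2.1⟩ := Subtype.ext h0
    have h2 := congrArg m h1
    rw [hm.invol, hm.invol] at h2
    have h3 := congrArg Subtype.val h2
    exact Subtype.ext h3
  · intro a
    have h : m ⟨a, a.2.1⟩ ≠ ⟨a, a.2.1⟩ := fun h => a.2.2 (by
      have := hS.isMissable_partner hm (a := ⟨a, a.2.1⟩) a.2.2
      rwa [h] at this)
    exact (hm.adj _ h).symm
  -- Since `m` fixes `d`, only `d` itself is sent to `d`, and `d` is not core.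
  · intro a had
    have h1 : m ⟨a, a.2.1⟩ = ⟨d, hd'⟩ := Subtype.ext had
    have h2 := congrArg m h1
    rw [hm.invol, hmd] at h2
    have h3 : (a : V) = d := Subtype.ext_iff.1 h2
    exact a.2.2 (h3 ▸ isMissable_iff.2 ⟨hd', hd⟩)

/-- The matching injects the core into the missable vertices. A covered missable vertex has a core
partner, so the missable vertices outside the image are exactly the missed ones. -/
lemma IsMetaSkeleton.ncard_compl_verts_add (hS : IsMetaSkeleton S X)
    {M : (S.induce Xᶜ).Subgraph} (hM : IsMaximumMatching M) :
    M.vertsᶜ.ncard + {v | IsCore S X v}.ncard = {v | IsMissable S X v}.ncard := by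
  classical
  obtain ⟨m, hm', h⟩ := exists_encodes hM.1
  have hm := (h.isMaximumMatching_iff hM.1 hm').1 hM
  have hcore : {v | IsCore S X v} = Subtype.val '' {v : ↥Xᶜ | ¬ IsMissable S X v} := by
    ext v
    constructor
    · exact fun hv => ⟨⟨v, hv.1⟩, hv.2, rfl⟩
    · rintro ⟨v, hv, rfl⟩
      exact ⟨v.2, hv⟩
  have hmiss : {v | IsMissable S X v} = Subtype.val '' {v : ↥Xᶜ | IsMissable S X v} := by
    ext v
    constructor
    · exact fun hv => ⟨⟨v, hv.1⟩, hv, rfl⟩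
    · rintro ⟨v, hv, rfl⟩
      exact hv
  have hinj : Function.Injective m := Function.LeftInverse.injective hm.invol
  rw [hcore, hmiss, Set.ncard_image_of_injective _ Subtype.coe_injective,
    Set.ncard_image_of_injective _ Subtype.coe_injective,
    ← Set.ncard_image_of_injective {v : ↥Xᶜ | ¬ IsMissable S X v} hinj,
    ← Set.ncard_union_eq]
  · congr 1
    ext v
    constructor
    · rintro (hv | ⟨a, ha, rfl⟩)
      · exact isMissable_coe_iff.2 ⟨M, hM, hv⟩
      · exact hS.isMissable_partner hm ha
    · intro hv
      by_cases hv' : v ∈ M.vertsᶜ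
      · exact Or.inl hv'
      · refine Or.inr ⟨m v, fun h' => ?_, hm.invol v⟩
        exact hS.not_adj_missable hv h' (hm.adj v ((h.2 v).1 (not_not.1 hv')))
  · rw [Set.disjoint_left]
    rintro _ hv ⟨a, ha, rfl⟩
    have hfix : m (m a) = m a := not_not.1 fun h' => hv ((h.2 _).2 h')
    have := hinj hfix
    exact ha (this ▸ hS.isMissable_partner hm ha)

end

/-! ### Flows and matrices supported on acyclic graphs -/

section

variable {V : Type u} [Fintype V] {G : SimpleGraph V}

/-- A circulation on a forest vanishes. -/
lemma circulation_eq_zero (hG : G.IsAcyclic) (f : V → V → ℝ) (hanti : ∀ a b, f a b = - f b a)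
    (hsupp : ∀ a b, ¬ G.Adj a b → f a b = 0) (hdiv : ∀ a, ∑ b, f a b = 0) (u v : V) :
    f u v = 0 := by
  classical
  by_cases h : G.Adj u v
  swap
  · exact hsupp _ _ h
  -- Sum the divergence over one side of `uv`: the flow inside cancels by antisymmetry, and only `f
  -- v u` crosses the cut.
  set U : Finset V := Finset.univ.filter (· ∈ farSide G u v) with hU
  have memU : ∀ a, a ∈ U ↔ a ∈ farSide G u v := fun a => by simp [hU]
  have h0 : ∑ a ∈ U, ∑ b, f a b = 0 := Finset.sum_eq_zero fun a _ => hdiv a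
  have h1 : ∑ a ∈ U, ∑ b ∈ U, f a b = 0 := by
    have h2 : ∑ a ∈ U, ∑ b ∈ U, f a b = - ∑ a ∈ U, ∑ b ∈ U, f a b := by
      conv_lhs => rw [Finset.sum_comm]
      rw [← Finset.sum_neg_distrib]
      refine Finset.sum_congr rfl fun a _ => ?_
      rw [← Finset.sum_neg_distrib]
      exact Finset.sum_congr rfl fun b _ => hanti b a
    linarith
  have h2 : ∑ a ∈ U, ∑ b ∈ Uᶜ, f a b = f v u := by
    have hz : ∀ a ∈ U, ∀ b ∈ Uᶜ, ¬ (a = v ∧ b = u) → f a b = 0 := fun a ha b hb hab => by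
      refine hsupp a b fun hadj => hab ?_
      exact eq_of_adj_of_mem_farSide hG h hadj ((memU a).1 ha)
        fun hb' => (Finset.mem_compl.1 hb) ((memU b).2 hb')
    have hvU : v ∈ U := (memU v).2 (mem_farSide_self G u v)
    have huU : u ∈ Uᶜ := Finset.mem_compl.2 fun h' => notMem_farSide hG h ((memU u).1 h')
    rw [Finset.sum_eq_single_of_mem v hvU, Finset.sum_eq_single_of_mem u huU]
    · exact fun b hb hbu => hz v hvU b hb fun h' => hbu h'.2
    · exact fun a ha hav => Finset.sum_eq_zero fun b hb => hz a ha b hb fun h' => hav h'.1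
  have h3 : ∑ a ∈ U, ∑ b, f a b = ∑ a ∈ U, ∑ b ∈ U, f a b + ∑ a ∈ U, ∑ b ∈ Uᶜ, f a b := by
    rw [← Finset.sum_add_distrib]
    exact Finset.sum_congr rfl fun a _ => (Finset.sum_add_sum_compl U _).symm
  rw [hanti]
  linarith

/-- A matrix whose entries are supported on the edges of a forest, together with a matching `f`
of its columns into its rows, has trivial kernel, even if only the rows in the image of `f` are
considered. -/
lemma eq_zero_of_mulVec_matching (hG : G.IsAcyclic) {α δ : Type u} [Fintype α]
    (ι : α → V) (κ : δ → V) (hι : Function.Injective ι) (hκ : Function.Injective κ)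
    (hικ : ∀ a d, ι a ≠ κ d) (W : Matrix δ α ℝ) (hW : ∀ d a, W d a ≠ 0 → G.Adj (κ d) (ι a))
    (f : α → δ) (hf : Function.Injective f) (hfW : ∀ a, W (f a) a ≠ 0) (t : α → ℝ)
    (ht : ∀ a, (W.mulVec t) (f a) = 0) : t = 0 := by
  classical
  by_contra hne
  obtain ⟨a₀, ha₀⟩ := Function.ne_iff.1 hne
  -- Infinite descent: take `a` in the support of `t` whose matching edge cuts off the fewest
  -- vertices on the side of `f a`. The equation at `f a` needs a second nonzero term `b`, whose own
  -- matching edge cuts off a strictly smaller set.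
  obtain ⟨a, ha, hmin⟩ := Finset.exists_min_image (Finset.univ.filter fun a => t a ≠ 0)
    (fun a => (farSide G (ι a) (κ (f a))).ncard) ⟨a₀, by simpa using ha₀⟩
  rw [Finset.mem_filter] at ha
  have hadj : ∀ a, G.Adj (κ (f a)) (ι a) := fun a => hW _ _ (hfW a)
  obtain ⟨b, hba, hb⟩ : ∃ b, b ≠ a ∧ W (f a) b * t b ≠ 0 := by
    by_contra! hcon
    have h1 := ht a
    rw [Matrix.mulVec, dotProduct, Finset.sum_eq_single a (fun b _ hb => hcon b hb)
      (fun h => absurd (Finset.mem_univ a) h)] at h1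
    exact mul_ne_zero (hfW a) ha.2 h1
  have htb : t b ≠ 0 := right_ne_zero_of_mul hb
  have hab : G.Adj (κ (f a)) (ι b) := hW _ _ (left_ne_zero_of_mul hb)
  have hbU : ι b ∈ farSide G (ι a) (κ (f a)) := by
    refine farSide_closed hab (fun h => ?_) (mem_farSide_self _ _ _)
    rcases Sym2.eq_iff.1 h with ⟨h1, -⟩ | ⟨-, h1⟩
    · exact hικ _ _ h1.symm
    · exact hba (hι h1)
  have hfab : κ (f a) ∉ farSide G (ι b) (κ (f b)) := fun h => by
    refine notMem_farSide hG (hadj b).symm (farSide_closed hab (fun h' => ?_) h)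
    rcases Sym2.eq_iff.1 h' with ⟨h1, -⟩ | ⟨h1, -⟩
    · exact hικ _ _ h1.symm
    · exact hba (hf (hκ h1)).symm
  have hsub : farSide G (ι b) (κ (f b)) ⊆ farSide G (ι a) (κ (f a)) := by
    rintro z ⟨p⟩
    have hstart : κ (f b) ∈ farSide G (ι a) (κ (f a)) := by
      refine farSide_closed (hadj b).symm (fun h => ?_) hbU
      rcases Sym2.eq_iff.1 h with ⟨h1, -⟩ | ⟨h1, -⟩
      · exact hba (hι h1)
      · exact hικ _ _ h1
    -- A walk leaving the side of `f a` must do so at `f a`, which would put `f a` on the side of `f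
    -- b`.
    by_contra hz
    obtain ⟨e, he, he1, he2⟩ := p.exists_boundary_dart _ hstart hz
    have hd := e.adj
    rw [SimpleGraph.deleteEdges_adj] at hd
    obtain ⟨h1, -⟩ := eq_of_adj_of_mem_farSide hG (hadj a).symm hd.1 he1 he2
    refine hfab ?_
    rw [← h1]
    exact ⟨p.takeUntil _ (p.dart_fst_mem_support_of_mem_darts he)⟩
  have hlt : (farSide G (ι b) (κ (f b))).ncard < (farSide G (ι a) (κ (f a))).ncard :=
    Set.ncard_lt_ncard ⟨hsub, fun h => notMem_farSide hG (hadj b).symm (h hbU)⟩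
  exact absurd (hmin b (by simpa using htb)) (not_le.2 hlt)

/-- The square submatrix on the rows `f a` has trivial kernel, hence is invertible. Solve there and
extend by zero; the support statement is what later keeps the row of `d` out of the combination. -/
lemma exists_vecMul_eq {α δ : Type u} [Fintype α] [Fintype δ] (W : Matrix δ α ℝ) (f : α → δ)
    (hf : ∀ t : α → ℝ, (∀ a, (W.mulVec t) (f a) = 0) → t = 0) (z : α → ℝ) :
    ∃ c : δ → ℝ, Matrix.vecMul c W = z ∧ ∀ d, (∀ a, f a ≠ d) → c d = 0 := by
  classical
  have hinj : Function.Injective (W.submatrix f id).mulVec := by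
    intro s t hst
    refine sub_eq_zero.1 (hf (s - t) fun a => ?_)
    have h1 : (W.submatrix f id).mulVec s a = (W.submatrix f id).mulVec t a := congrFun hst a
    rw [Matrix.mulVec_sub, Pi.sub_apply]
    exact sub_eq_zero.2 h1
  obtain ⟨c, hc⟩ :=
    Matrix.vecMul_surjective_iff_isUnit.2 (Matrix.mulVec_injective_iff_isUnit.1 hinj) z
  refine ⟨∑ a, c a • Pi.single (f a) 1, ?_, fun d hd => ?_⟩
  · rw [← hc, Matrix.sum_vecMul]
    ext b
    simp [Matrix.vecMul, dotProduct, Finset.sum_apply, Pi.single_apply]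
  · simp only [Finset.sum_apply, Pi.smul_apply, smul_eq_mul]
    refine Finset.sum_eq_zero fun a _ => ?_
    rw [Pi.single_eq_of_ne (hd a).symm, mul_zero]

end

/-! ### Eigenvectors -/

section

variable {V : Type u} [Fintype V] {G : SimpleGraph V} {lam : ℝ}

open Classical in
lemma adjEnd_apply (G : SimpleGraph V) (x : V → ℝ) (v : V) :
    adjEnd G x v = ∑ w, if G.Adj v w then x w else 0 := by
  simp [adjEnd, Matrix.mulVec, dotProduct, SimpleGraph.adjMatrix_apply]

lemma mem_eigenspace_iff {x : V → ℝ} :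
    x ∈ Module.End.eigenspace (adjEnd G) lam ↔ ∀ v, adjEnd G x v = lam * x v := by
  rw [Module.End.mem_eigenspace_iff, funext_iff]
  rfl

lemma sum_mul_adjEnd_comm (G : SimpleGraph V) (x y : V → ℝ) :
    ∑ v, y v * adjEnd G x v = ∑ v, x v * adjEnd G y v := by
  classical
  simp only [adjEnd_apply, Finset.mul_sum]
  rw [Finset.sum_comm]
  refine Finset.sum_congr rfl fun a _ => Finset.sum_congr rfl fun b _ => ?_
  simp only [G.adj_comm a b]
  split_ifs <;> ring

/-- An eigenvector of a tree without zero entries spans its eigenspace. -/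
lemma exists_smul_of_nowhere_zero (hG : G.IsTree) {x y : V → ℝ}
    (hx : ∀ v, adjEnd G x v = lam * x v) (hy : ∀ v, adjEnd G y v = lam * y v)
    (hy0 : ∀ v, y v ≠ 0) : ∃ c : ℝ, ∀ v, x v = c * y v := by
  classical
  -- The two eigenvalue equations make `y a * x b - y b * x a` a circulation. Its vanishing says
  -- that `x / y` is constant along edges.
  have key := circulation_eq_zero hG.isAcyclic
    (fun a b => if G.Adj a b then y a * x b - y b * x a else 0) (fun a b => by
      simp only [G.adj_comm a b]
      split_ifs <;> ring) (fun a b h => if_neg h) (fun a => by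
      have h1 := hx a
      have h2 := hy a
      rw [adjEnd_apply] at h1 h2
      have h3 : ∀ b, (if G.Adj a b then y a * x b - y b * x a else 0) =
          y a * (if G.Adj a b then x b else 0) - (if G.Adj a b then y b else 0) * x a := fun b => by
        split_ifs <;> ring
      simp only [h3]
      rw [Finset.sum_sub_distrib, ← Finset.mul_sum, ← Finset.sum_mul, h1, h2]
      ring)
  have hstep : ∀ a b, G.Adj a b → x b / y b = x a / y a := fun a b hab => by
    have := key a b
    simp only [if_pos hab] at this
    rw [div_eq_div_iff (hy0 b) (hy0 a)]
    linarith
  obtain ⟨r⟩ := hG.connected.nonempty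
  refine ⟨x r / y r, fun v => ?_⟩
  have : x v / y v = x r / y r := by
    obtain ⟨p⟩ := hG.connected.preconnected v r
    induction p with
    | nil => rfl
    | cons h p ih => rw [← ih, hstep _ _ h]
  rw [← this, div_mul_cancel₀ _ (hy0 v)]

end

lemma sum_eq_sum_subtype {V : Type u} [Fintype V] (P : V → Prop) [Fintype {v // P v}] (g : V → ℝ)
    (h : ∀ v, ¬ P v → g v = 0) : ∑ v, g v = ∑ v : {v // P v}, g v := by
  classical
  rw [← Finset.sum_filter_of_ne (p := P) fun v _ hv => not_not.1 fun hP => hv (h v hP)]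
  exact Finset.sum_subtype _ (by simp) g

namespace BlowUp

section

variable {V : Type u} {S : SimpleGraph V} {X : Set V} {lam : ℝ} (B : BlowUp.{u, w} S X lam)

/-! ### Adjacency in the blown-up graph -/

lemma adj_same_iff {v : V} {a b : B.Part v} :
    B.graph.Adj ⟨v, a⟩ ⟨v, b⟩ ↔ (B.part v).Adj a b := by
  refine ⟨fun h => ?_, fun h => Adj.inner h⟩
  cases h with
  | inner h => exact h
  | link h => exact (S.loopless.irrefl _ h).elim

lemma adj_iff_of_ne {u v : V} (huv : u ≠ v) {a : B.Part u} {b : B.Part v} :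
    B.graph.Adj ⟨u, a⟩ ⟨v, b⟩ ↔ S.Adj u v ∧ B.attach u v = a ∧ B.attach v u = b := by
  constructor
  · intro h
    cases h with
    | inner h => exact (huv rfl).elim
    | link h => exact ⟨h, rfl, rfl⟩
  · rintro ⟨h, rfl, rfl⟩
    exact Adj.link h

lemma fst_adj_of_adj {p q : B.Vert} (h : B.graph.Adj p q) (hne : p.1 ≠ q.1) : S.Adj p.1 q.1 :=
  ((B.adj_iff_of_ne hne).1 h).1

instance (v : V) : Nonempty (B.Part v) := (B.part_isTree v).connected.nonempty

/-! ### The blown-up graph is a tree -/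

/-- The inclusion of a substituted tree. -/
def partHom (v : V) : B.part v →g B.graph where
  toFun a := ⟨v, a⟩
  map_rel' h := Adj.inner h

lemma reachable_part {v : V} (a b : B.Part v) : B.graph.Reachable ⟨v, a⟩ ⟨v, b⟩ :=
  ((B.part_isTree v).connected.preconnected a b).map (B.partHom v)

lemma graph_connected (hS : S.IsTree) : B.graph.Connected := by
  have h : ∀ u v : V, ∀ a b, B.graph.Reachable ⟨u, a⟩ ⟨v, b⟩ := fun u v => by
    obtain ⟨p⟩ := hS.connected.preconnected u v
    induction p with
    | nil => exact B.reachable_part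
    | @cons u v w huv p ih =>
      intro a b
      exact (B.reachable_part a _).trans
        ((SimpleGraph.Adj.reachable (Adj.link huv)).trans (ih _ b))
  obtain ⟨r⟩ := hS.connected.nonempty
  have : Nonempty B.Vert := ⟨⟨r, Classical.arbitrary _⟩⟩
  exact ⟨fun p q => h p.1 q.1 p.2 q.2⟩

/-- Connectedness bounds the number of edges from below. For the upper bound, darts inject into the
darts of the parts and of `S`, because a link is determined by the edge of `S` beneath it. -/
lemma graph_isTree [Fintype V] (hS : S.IsTree) : B.graph.IsTree := by
  classical
  have hconn := B.graph_connected hS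
  rw [SimpleGraph.isTree_iff_connected_and_card]
  refine ⟨hconn, le_antisymm ?_ ?_⟩
  · let f : B.graph.Dart → (Σ v, (B.part v).Dart) ⊕ S.Dart := fun e =>
      if h : e.fst.1 = e.snd.1 then
        Sum.inl ⟨e.snd.1, ⟨(h ▸ e.fst.2, e.snd.2), by
          obtain ⟨⟨⟨u, a⟩, ⟨v, b⟩⟩, hab⟩ := e
          obtain rfl : u = v := h
          exact B.adj_same_iff.1 hab⟩⟩
      else Sum.inr ⟨(e.fst.1, e.snd.1), B.fst_adj_of_adj e.adj h⟩
    have hf : Function.Injective f := by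
      rintro ⟨⟨⟨u, a⟩, ⟨v, b⟩⟩, hab⟩ ⟨⟨⟨u', a'⟩, ⟨v', b'⟩⟩, hab'⟩ h
      by_cases h1 : u = v <;> by_cases h2 : u' = v'
      · subst h1 h2
        simp only [f, dif_pos, Sum.inl.injEq, Sigma.mk.injEq] at h
        obtain ⟨rfl, h⟩ := h
        simp only [heq_eq_eq, SimpleGraph.Dart.mk.injEq, Prod.mk.injEq] at h
        obtain ⟨rfl, rfl⟩ := h
        rfl
      · simp [f, h1, h2] at h
      · simp [f, h1, h2] at h
      · simp only [f, h1, h2, dite_false, Sum.inr.injEq, SimpleGraph.Dart.mk.injEq,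
          Prod.mk.injEq] at h
        obtain ⟨rfl, rfl⟩ := h
        obtain ⟨-, rfl, rfl⟩ := (B.adj_iff_of_ne h1).1 hab
        obtain ⟨-, rfl, rfl⟩ := (B.adj_iff_of_ne h1).1 hab'
        rfl
    have hcard := Fintype.card_le_of_injective f hf
    rw [Fintype.card_sum, Fintype.card_sigma, SimpleGraph.dart_card_eq_twice_card_edges,
      SimpleGraph.dart_card_eq_twice_card_edges] at hcard
    simp only [SimpleGraph.dart_card_eq_twice_card_edges] at hcard
    rw [← Finset.mul_sum] at hcard
    have h1 := hS.card_edgeFinset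
    have h2 : ∑ v, ((B.part v).edgeFinset.card + 1) = ∑ v, Fintype.card (B.Part v) :=
      Finset.sum_congr rfl fun v _ => (B.part_isTree v).card_edgeFinset
    rw [Finset.sum_add_distrib] at h2
    simp only [Finset.sum_const, Finset.card_univ, smul_eq_mul, mul_one] at h2
    rw [Nat.card_eq_fintype_card, Nat.card_eq_fintype_card, Fintype.card_sigma, ← h2,
      ← SimpleGraph.edgeFinset_card]
    omega
  · exact hconn.card_vert_le_card_edgeSet_add_one

/-! ### The eigenspace of the blown-up graph -/

open Classical in
/-- A chosen nowhere vanishing eigenvector of the tree substituted for a missable vertex. -/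
def vec (v : V) : B.Part v → ℝ :=
  if h : IsMissable S X v then Classical.choose (B.part_of_missable v h) else 0

lemma vec_ne_zero {v : V} (h : IsMissable S X v) (a : B.Part v) : B.vec v a ≠ 0 := by
  rw [vec, dif_pos h]
  exact (Classical.choose_spec (B.part_of_missable v h)).2 a

lemma adjEnd_vec {v : V} (h : IsMissable S X v) (a : B.Part v) :
    adjEnd (B.part v) (B.vec v) a = lam * B.vec v a := by
  rw [vec, dif_pos h]
  exact mem_eigenspace_iff.1 (Classical.choose_spec (B.part_of_missable v h)).1.1 a

open Classical in
/-- The values of the chosen eigenvectors at the ends of the edges between missable and core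
vertices. -/
def linkMatrix : Matrix {v // IsMissable S X v} {v // IsCore S X v} ℝ :=
  fun d a => if S.Adj d a then B.vec d (B.attach d a) else 0

open Classical in
/-- The vector with coefficients `c` on the chosen eigenvectors, zero elsewhere. -/
def spread : ({v // IsMissable S X v} → ℝ) →ₗ[ℝ] (B.Vert → ℝ) where
  toFun c p := if h : IsMissable S X p.1 then c ⟨p.1, h⟩ * B.vec p.1 p.2 else 0
  map_add' c d := by
    ext p
    simp only [Pi.add_apply]
    split_ifs
    · ring
    · simp
  map_smul' r c := by
    ext p
    simp only [Pi.smul_apply, smul_eq_mul, RingHom.id_apply]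
    split_ifs
    · ring
    · simp

lemma spread_of_missable (c : {v // IsMissable S X v} → ℝ) {v : V} (h : IsMissable S X v)
    (a : B.Part v) : B.spread c ⟨v, a⟩ = c ⟨v, h⟩ * B.vec v a :=
  dif_pos h

lemma spread_of_not (c : {v // IsMissable S X v} → ℝ) {p : B.Vert} (h : ¬ IsMissable S X p.1) :
    B.spread c p = 0 :=
  dif_neg h

lemma spread_injective : Function.Injective B.spread := by
  rw [← LinearMap.ker_eq_bot, LinearMap.ker_eq_bot']
  intro c hc
  ext ⟨v, hv⟩
  -- The diagonal value `attach v v` corresponds to no edge; it only serves as some vertex of the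
  -- part.
  have h := congrFun hc ⟨v, B.attach v v⟩
  rw [B.spread_of_missable c hv] at h
  exact (mul_eq_zero.1 h).resolve_right (B.vec_ne_zero hv _)

end

section

variable {V : Type u} [Fintype V] {S : SimpleGraph V} {X : Set V} {lam : ℝ}
  (B : BlowUp.{u, w} S X lam)

open Classical in
lemma adjEnd_graph (x : B.Vert → ℝ) (v : V) (a : B.Part v) :
    adjEnd B.graph x ⟨v, a⟩ = adjEnd (B.part v) (fun b => x ⟨v, b⟩) a +
      ∑ u, if S.Adj v u ∧ B.attach v u = a then x ⟨u, B.attach u v⟩ else 0 := by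
  rw [adjEnd_apply, Fintype.sum_sigma]
  have h : ∀ u, (∑ b, if B.graph.Adj ⟨v, a⟩ ⟨u, b⟩ then x ⟨u, b⟩ else 0) =
      (if u = v then adjEnd (B.part v) (fun b => x ⟨v, b⟩) a else 0) +
        if S.Adj v u ∧ B.attach v u = a then x ⟨u, B.attach u v⟩ else 0 := by
    intro u
    by_cases huv : u = v
    · subst huv
      rw [if_pos rfl, if_neg (fun h => S.loopless.irrefl _ h.1), add_zero, adjEnd_apply]
      simp only [B.adj_same_iff]
    · rw [if_neg huv, zero_add]
      simp only [B.adj_iff_of_ne (Ne.symm huv)]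
      by_cases h : S.Adj v u ∧ B.attach v u = a
      · rw [if_pos h, Finset.sum_eq_single (B.attach u v)]
        · rw [if_pos ⟨h.1, h.2, rfl⟩]
        · exact fun b _ hb => if_neg fun h' => hb h'.2.2.symm
        · exact fun h' => absurd (Finset.mem_univ _) h'
      · rw [if_neg h]
        exact Finset.sum_eq_zero fun b _ => if_neg fun h' => h ⟨h'.1, h'.2.1⟩
  rw [Finset.sum_congr rfl fun u _ => h u, Finset.sum_add_distrib]
  simp

open Classical in
lemma eq_zero_of_linkMatrix (hS : IsMetaSkeleton S X)
    {f : {v // IsCore S X v} → {v // IsMissable S X v}} (hf : Function.Injective f)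
    (hfS : ∀ a, S.Adj (f a) a) (t : {v // IsCore S X v} → ℝ)
    (ht : ∀ a, (B.linkMatrix.mulVec t) (f a) = 0) : t = 0 := by
  refine eq_zero_of_mulVec_matching hS.isTree.isAcyclic Subtype.val Subtype.val
    Subtype.val_injective Subtype.val_injective (fun a d h => a.2.2 (h ▸ d.2)) B.linkMatrix
    (fun d a h => ?_) f hf (fun a => ?_) t ht
  · by_contra h'
    exact h (if_neg h')
  · rw [linkMatrix, if_pos (hfS a)]
    exact B.vec_ne_zero (f a).2 _

/-- Pair the equation on the part of `e = f a` with `vec e`. By symmetry of the adjacency matrix the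
terms inside the part cancel, leaving row `e` of `linkMatrix` applied to the core values. The rows
in the image of `f` suffice. -/
lemma eq_zero_of_isCore (hS : IsMetaSkeleton S X) {d : V} (hd : IsMissable S X d)
    {x : B.Vert → ℝ} (hx : ∀ p, adjEnd B.graph x p = lam * x p) {p : B.Vert}
    (hp : IsCore S X p.1) : x p = 0 := by
  classical
  obtain ⟨f, hf, hfS, -⟩ := hS.exists_matching_avoiding hd
  have hsub : ∀ v, IsCore S X v → Subsingleton (B.Part v) := fun v hv => B.part_of_other v hv.1 hv.2
  have h0 := B.eq_zero_of_linkMatrix hS hf hfS (fun a => x ⟨a, B.attach a a⟩) fun a => by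
    set e := f a
    have h1 : ∑ q, B.vec e q * adjEnd B.graph x ⟨e, q⟩ = ∑ q, B.vec e q * (lam * x ⟨e, q⟩) :=
      Finset.sum_congr rfl fun q _ => by rw [hx]
    simp only [B.adjEnd_graph, mul_add] at h1
    rw [Finset.sum_add_distrib, sum_mul_adjEnd_comm] at h1
    simp only [B.adjEnd_vec e.2] at h1
    have h2 : ∑ q, x ⟨e, q⟩ * (lam * B.vec e q) = ∑ q, B.vec e q * (lam * x ⟨e, q⟩) :=
      Finset.sum_congr rfl fun q _ => by ring
    rw [h2, add_eq_left] at h1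
    simp only [Finset.mul_sum] at h1
    rw [Finset.sum_comm] at h1
    have h3 : ∀ u, (∑ q, B.vec e q *
        (if S.Adj e u ∧ B.attach e u = q then x ⟨u, B.attach u e⟩ else 0)) =
        if S.Adj e u then B.vec e (B.attach e u) * x ⟨u, B.attach u e⟩ else 0 := fun u => by
      by_cases hu : S.Adj e u
      · simp [hu]
      · simp [hu]
    rw [Finset.sum_congr rfl fun u _ => h3 u, sum_eq_sum_subtype (IsCore S X)] at h1
    · rw [Matrix.mulVec, dotProduct, ← h1]
      refine Finset.sum_congr rfl fun b _ => ?_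
      have := hsub b b.2
      rw [Subsingleton.elim (B.attach b b) (B.attach b e), linkMatrix]
      split_ifs <;> simp
    · intro v hv
      refine if_neg fun h' => hv (hS.isCore_of_adj (fun h'' => h''.2 e.2) h')
  obtain ⟨v, q⟩ := p
  have := hsub v hp
  have := congrFun h0 ⟨v, hp⟩
  rw [Subsingleton.elim q (B.attach v v)]
  exact this

/-- Outside the core, an eigenvector restricts to solutions of the eigenvalue equation of the
substituted trees. -/
lemma adjEnd_part (hS : IsMetaSkeleton S X) {x : B.Vert → ℝ}
    (hcore : ∀ p : B.Vert, IsCore S X p.1 → x p = 0) {v : V} (hv : ¬ IsCore S X v)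
    (a : B.Part v) :
    adjEnd B.graph x ⟨v, a⟩ = adjEnd (B.part v) (fun b => x ⟨v, b⟩) a := by
  classical
  rw [B.adjEnd_graph, Finset.sum_eq_zero, add_zero]
  intro u _
  split_ifs with h
  · exact hcore _ (hS.isCore_of_adj hv h.1)
  · rfl

/-- With zero core values, a nonzero restriction to this part would be an eigenvector of a tree
without eigenvalue `lam`. -/
lemma eq_zero_of_mem (hS : IsMetaSkeleton S X) {d : V} (hd : IsMissable S X d)
    {x : B.Vert → ℝ} (hx : ∀ p, adjEnd B.graph x p = lam * x p) {p : B.Vert}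
    (hp : p.1 ∈ X) : x p = 0 := by
  obtain ⟨v, a⟩ := p
  by_contra hne
  refine B.part_of_mem v hp (Module.End.hasEigenvalue_of_hasEigenvector
    (x := fun b => x ⟨v, b⟩) ⟨mem_eigenspace_iff.2 fun b => ?_, fun h => hne (congrFun h a)⟩)
  rw [← B.adjEnd_part hS (fun p => B.eq_zero_of_isCore hS hd hx) (fun h => h.1 hp), hx]

lemma exists_eq_mul_vec (hS : IsMetaSkeleton S X) {x : B.Vert → ℝ}
    (hx : ∀ p, adjEnd B.graph x p = lam * x p) {v : V} (hv : IsMissable S X v) :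
    ∃ c : ℝ, ∀ a, x ⟨v, a⟩ = c * B.vec v a :=
  exists_smul_of_nowhere_zero (lam := lam) (B.part_isTree v) (fun a => by
    rw [← B.adjEnd_part hS (fun p => B.eq_zero_of_isCore hS hv hx) (fun h => h.2 hv), hx])
    (B.adjEnd_vec hv) (B.vec_ne_zero hv)

open Classical in
lemma adjEnd_spread_of_isCore (c : {v // IsMissable S X v} → ℝ) {v : V} (hv : IsCore S X v)
    (a : B.Part v) :
    adjEnd B.graph (B.spread c) ⟨v, a⟩ = Matrix.vecMul c B.linkMatrix ⟨v, hv⟩ := by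
  have := B.part_of_other v hv.1 hv.2
  have h0 : (fun b => B.spread c ⟨v, b⟩) = 0 := funext fun b => B.spread_of_not c hv.2
  rw [B.adjEnd_graph, h0, map_zero, Pi.zero_apply, zero_add, Matrix.vecMul, dotProduct,
    sum_eq_sum_subtype (IsMissable S X)]
  · refine Finset.sum_congr rfl fun d _ => ?_
    rw [B.spread_of_missable c d.2, linkMatrix]
    by_cases h : S.Adj v d
    · rw [if_pos ⟨h, Subsingleton.elim _ _⟩, if_pos h.symm]
    · rw [if_neg (fun h' => h h'.1), if_neg (fun h' => h h'.symm), mul_zero]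
  · intro u hu
    rw [B.spread_of_not c hu, ite_self]

open Classical in
-- Off the core the equations hold automatically; each core vertex contributes one column of the
-- condition on `c`.
lemma spread_mem_eigenspace_iff (hS : IsMetaSkeleton S X) (c : {v // IsMissable S X v} → ℝ) :
    B.spread c ∈ Module.End.eigenspace (adjEnd B.graph) lam ↔
      Matrix.vecMul c B.linkMatrix = 0 := by
  rw [mem_eigenspace_iff]
  constructor
  · intro h
    ext ⟨v, hv⟩
    rw [← B.adjEnd_spread_of_isCore c hv (B.attach v v), h, B.spread_of_not c hv.2, mul_zero]
    rfl
  · rintro h ⟨v, a⟩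
    by_cases hv : IsCore S X v
    · rw [B.adjEnd_spread_of_isCore c hv, h, B.spread_of_not c hv.2, mul_zero]
      rfl
    · rw [B.adjEnd_part hS (fun p hp => B.spread_of_not c hp.2) hv]
      by_cases hm : IsMissable S X v
      · have h1 : (fun b => B.spread c ⟨v, b⟩) = c ⟨v, hm⟩ • B.vec v :=
          funext fun b => B.spread_of_missable c hm b
        rw [h1, map_smul, Pi.smul_apply, B.adjEnd_vec hm, B.spread_of_missable c hm, smul_eq_mul]
        ring
      · have h1 : (fun b => B.spread c ⟨v, b⟩) = 0 := funext fun b => B.spread_of_not c hm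
        rw [h1, map_zero, B.spread_of_not c hm, mul_zero]
        rfl

open Classical in
lemma exists_spread_eq (hS : IsMetaSkeleton S X) {d : V} (hd : IsMissable S X d)
    {x : B.Vert → ℝ} (hx : x ∈ Module.End.eigenspace (adjEnd B.graph) lam) :
    ∃ c, Matrix.vecMul c B.linkMatrix = 0 ∧ B.spread c = x := by
  have hx' := mem_eigenspace_iff.1 hx
  choose c hc using fun v : {v // IsMissable S X v} => B.exists_eq_mul_vec hS hx' v.2
  have hcx : B.spread c = x := by
    ext ⟨v, a⟩
    by_cases hv : IsMissable S X v
    · rw [B.spread_of_missable c hv, hc ⟨v, hv⟩ a]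
    · rw [B.spread_of_not c hv]
      by_cases hvX : v ∈ X
      · rw [B.eq_zero_of_mem hS hd hx' hvX]
      · rw [B.eq_zero_of_isCore hS hd hx' ⟨hvX, hv⟩]
  exact ⟨c, (B.spread_mem_eigenspace_iff hS c).1 (hcx ▸ hx), hcx⟩

open Classical in
-- Match the core into the missable vertices other than `d`. The row of `d` is then a combination of
-- matched rows, and subtracting it gives a relation with coefficient `-1` at `d`.
lemma exists_coeff_ne_zero (hS : IsMetaSkeleton S X) {d : V} (hd : IsMissable S X d) :
    ∃ c, Matrix.vecMul c B.linkMatrix = 0 ∧ c ⟨d, hd⟩ ≠ 0 := by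
  obtain ⟨f, hf, hfS, hfd⟩ := hS.exists_matching_avoiding hd
  obtain ⟨c, hc, hc'⟩ := exists_vecMul_eq B.linkMatrix f (B.eq_zero_of_linkMatrix hS hf hfS)
    (Matrix.vecMul (Pi.single ⟨d, hd⟩ 1) B.linkMatrix)
  refine ⟨c - Pi.single ⟨d, hd⟩ 1, ?_, ?_⟩
  · rw [Matrix.sub_vecMul, hc, sub_self]
  · rw [Pi.sub_apply, hc' ⟨d, hd⟩ fun a h => hfd a (congrArg Subtype.val h)]
    simp

lemma exists_isEigenvector_ne_zero (hS : IsMetaSkeleton S X) {p : B.Vert}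
    (hp : IsMissable S X p.1) : ∃ x, IsEigenvector B.graph lam x ∧ x p ≠ 0 := by
  classical
  obtain ⟨v, a⟩ := p
  obtain ⟨c, hc, hc'⟩ := B.exists_coeff_ne_zero hS hp
  have h : B.spread c ⟨v, a⟩ ≠ 0 := by
    rw [B.spread_of_missable c hp]
    exact mul_ne_zero hc' (B.vec_ne_zero hp a)
  exact ⟨B.spread c, ⟨(B.spread_mem_eigenspace_iff hS c).2 hc, fun h' => h (by rw [h']; rfl)⟩, h⟩

/-- Rank-nullity: `spread` identifies the left kernel of `linkMatrix` with the eigenspace, and the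
matching makes left multiplication surjective. -/
lemma multiplicity_add (hS : IsMetaSkeleton S X) {d : V} (hd : IsMissable S X d) :
    multiplicity B.graph lam + {v | IsCore S X v}.ncard = {v | IsMissable S X v}.ncard := by
  classical
  have heq : Module.End.eigenspace (adjEnd B.graph) lam =
      (LinearMap.ker B.linkMatrix.vecMulLinear).map B.spread := by
    ext x
    constructor
    · intro hx
      obtain ⟨c, hc, rfl⟩ := B.exists_spread_eq hS hd hx
      exact ⟨c, hc, rfl⟩
    · rintro ⟨c, hc, rfl⟩
      exact (B.spread_mem_eigenspace_iff hS c).2 hc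
  have hsurj : LinearMap.range B.linkMatrix.vecMulLinear = ⊤ := by
    rw [LinearMap.range_eq_top]
    intro z
    obtain ⟨f, hf, hfS, -⟩ := hS.exists_matching_avoiding hd
    obtain ⟨c, hc, -⟩ := exists_vecMul_eq B.linkMatrix f (B.eq_zero_of_linkMatrix hS hf hfS) z
    exact ⟨c, hc⟩
  have hrank := LinearMap.finrank_range_add_finrank_ker B.linkMatrix.vecMulLinear
  rw [hsurj, finrank_top, Module.finrank_fintype_fun_eq_card,
    Module.finrank_fintype_fun_eq_card] at hrank
  rw [multiplicity, heq,
    ← (Submodule.equivMapOfInjective _ B.spread_injective _).finrank_eq]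
  have h1 : {v | IsCore S X v}.ncard = Fintype.card {v // IsCore S X v} := by
    rw [← Nat.card_eq_fintype_card]; rfl
  have h2 : {v | IsMissable S X v}.ncard = Fintype.card {v // IsMissable S X v} := by
    rw [← Nat.card_eq_fintype_card]; rfl
  omega

/-! ### The vanishing sets -/

lemma commonZeroSet_eq (hS : IsMetaSkeleton S X) (hX : X ≠ Set.univ) :
    commonZeroSet B.graph lam = {p | ¬ IsMissable S X p.1} := by
  classical
  obtain ⟨d, hd⟩ := hS.exists_isMissable hX
  ext p
  constructor
  · intro h hp
    obtain ⟨x, hx, hxp⟩ := B.exists_isEigenvector_ne_zero hS hp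
    exact hxp (h x hx)
  · intro hp x hx
    obtain ⟨c, -, rfl⟩ := B.exists_spread_eq hS hd hx.1
    exact B.spread_of_not c hp

lemma commonBoundaryZeroSet_eq (hS : IsMetaSkeleton S X) (hX : X ≠ Set.univ) :
    commonBoundaryZeroSet B.graph lam = {p | IsCore S X p.1} := by
  classical
  obtain ⟨d, hd⟩ := hS.exists_isMissable hX
  ext ⟨v, a⟩
  constructor
  · rintro ⟨x, hx, hxp, ⟨u, b⟩, hq, hpq⟩
    obtain ⟨c, -, rfl⟩ := B.exists_spread_eq hS hd hx.1
    have hu : IsMissable S X u := by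
      by_contra hu
      exact hq (B.spread_of_not c hu)
    -- Within a missable part, a multiple of a nowhere zero vector with one zero vanishes
    -- throughout, so a boundary vertex lies in a different part from its nonzero neighbour.
    by_cases huv : u = v
    · subst huv
      refine absurd ?_ hq
      have h1 : B.spread c ⟨u, a⟩ = 0 := hxp
      rw [B.spread_of_missable c hu] at h1
      change B.spread c ⟨u, b⟩ = 0
      rw [B.spread_of_missable c hu, (mul_eq_zero.1 h1).resolve_right (B.vec_ne_zero hu a),
        zero_mul]
    · exact hS.isCore_of_adj (fun h => h.2 hu) (B.fst_adj_of_adj hpq.symm huv)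
  · intro hv
    obtain ⟨f, -, hfS, -⟩ := hS.exists_matching_avoiding hd
    have hv' : IsCore S X v := hv
    have := B.part_of_other v hv'.1 hv'.2
    obtain ⟨x, hx, hxq⟩ := B.exists_isEigenvector_ne_zero hS
      (p := ⟨f ⟨v, hv⟩, B.attach (f ⟨v, hv⟩) v⟩) (f ⟨v, hv⟩).2
    refine ⟨x, hx, B.eq_zero_of_isCore hS hd (mem_eigenspace_iff.1 hx.1) hv, _, hxq, ?_⟩
    rw [Subsingleton.elim a (B.attach v (f ⟨v, hv⟩))]
    exact Adj.link (hfS ⟨v, hv⟩).symm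

end

/-! ### Contractions of the blown-up graph -/

section

variable {V : Type u} {S : SimpleGraph V} {X : Set V} {lam : ℝ} (B : BlowUp.{u, w} S X lam)

/-- If `K` is independent, then contracting the components on the parts over `K` identifies
precisely the vertices of a common such part. -/
lemma contractMk_eq_iff {K : Set V} (hK : ∀ u ∈ K, ∀ v ∈ K, ¬ S.Adj u v) {Z : Set B.Vert}
    (hZ : ∀ p, p ∈ Zᶜ ↔ p.1 ∈ K) {p q : B.Vert} :
    contractMk B.graph Z p = contractMk B.graph Z q ↔ p = q ∨ (p.1 = q.1 ∧ p.1 ∈ K) := by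
  rw [contractMk, contractMk, Quotient.eq]
  refine or_congr_right ⟨?_, ?_⟩
  · rintro ⟨hp, hq, ⟨r⟩⟩
    refine ⟨?_, (hZ p).1 hp⟩
    have key : ∀ a b : ↥Zᶜ, (B.graph.induce Zᶜ).Walk a b → a.1.1 = b.1.1 := by
      intro a b r
      induction r with
      | nil => rfl
      | @cons a b c h r ih =>
        rw [← ih]
        by_contra hne
        exact hK _ ((hZ _).1 a.2) _ ((hZ _).1 b.2) (B.fst_adj_of_adj h hne)
    exact key _ _ r
  · obtain ⟨v, a⟩ := p
    obtain ⟨u, b⟩ := q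
    rintro ⟨h, hv⟩
    obtain rfl : v = u := h
    have hmem : ∀ b : B.Part v, (⟨v, b⟩ : B.Vert) ∈ Zᶜ := fun b => (hZ _).2 hv
    let φ : B.part v →g B.graph.induce Zᶜ :=
      { toFun := fun b => ⟨⟨v, b⟩, hmem b⟩
        map_rel' := fun h => Adj.inner h }
    exact ⟨hmem a, hmem b, ((B.part_isTree v).connected.preconnected a b).map φ⟩

/-- `L` consists of base vertices whose parts become single points. It is `Xᶜ` for the skeleton,
where parts over `X` stay uncontracted but are discarded, and everything for the meta skeleton. -/
lemma contract_adj_iff {Z : Set B.Vert} {L : Set V}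
    (hfst : ∀ p q, contractMk B.graph Z p = contractMk B.graph Z q → p.1 = q.1)
    (hL : ∀ p q : B.Vert, p.1 ∈ L → p.1 = q.1 → contractMk B.graph Z p = contractMk B.graph Z q)
    {p q : B.Vert} (hp : p.1 ∈ L) (hq : q.1 ∈ L) :
    (contract B.graph Z).Adj (contractMk B.graph Z p) (contractMk B.graph Z q) ↔
      S.Adj p.1 q.1 := by
  rw [contract, SimpleGraph.map_adj']
  constructor
  · rintro ⟨hne, p', q', h, hp', hq'⟩
    rw [← hfst _ _ hp', ← hfst _ _ hq']
    refine B.fst_adj_of_adj h fun h' => hne (hL p q hp ?_)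
    rw [← hfst _ _ hp', ← hfst _ _ hq', h']
  · intro h
    exact ⟨fun h' => h.ne (hfst _ _ h'), ⟨p.1, B.attach p.1 q.1⟩, ⟨q.1, B.attach q.1 p.1⟩,
      Adj.link h, hL ⟨_, _⟩ p hp rfl, hL ⟨_, _⟩ q hq rfl⟩

variable [Fintype V]

lemma exists_skeleton_iso (hS : IsMetaSkeleton S X) (hX : X ≠ Set.univ) :
    ∃ ψ : skeleton B.graph lam ≃g S.induce Xᶜ,
      ∀ (p : B.Vert) (hp : contractMk B.graph (commonZeroSet B.graph lam) p ∈
        skeletonVerts B.graph lam), (ψ ⟨_, hp⟩ : V) = p.1 := by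
  have hmk : ∀ {p q : B.Vert}, contractMk B.graph (commonZeroSet B.graph lam) p =
      contractMk B.graph (commonZeroSet B.graph lam) q ↔
        p = q ∨ (p.1 = q.1 ∧ IsMissable S X p.1) :=
    B.contractMk_eq_iff (K := {v | IsMissable S X v})
      (fun u hu v hv => hS.not_adj_missable hu hv) fun p => by
        rw [B.commonZeroSet_eq hS hX]
        exact not_not
  have hfst : ∀ p q : B.Vert, contractMk B.graph (commonZeroSet B.graph lam) p =
      contractMk B.graph (commonZeroSet B.graph lam) q → p.1 = q.1 := fun p q h => by
    rcases hmk.1 h with rfl | h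
    · rfl
    · exact h.1
  have hL : ∀ p q : B.Vert, p.1 ∈ Xᶜ → p.1 = q.1 →
      contractMk B.graph (commonZeroSet B.graph lam) p =
        contractMk B.graph (commonZeroSet B.graph lam) q := by
    rintro ⟨v, a⟩ ⟨u, b⟩ hv h
    obtain rfl : v = u := h
    by_cases hm : IsMissable S X v
    · exact hmk.2 (Or.inr ⟨rfl, hm⟩)
    · have := B.part_of_other v hv hm
      rw [Subsingleton.elim a b]
  have hverts : ∀ p : B.Vert, contractMk B.graph (commonZeroSet B.graph lam) p ∈
      skeletonVerts B.graph lam ↔ p.1 ∈ Xᶜ := fun p => by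
    have hmem : ∀ q : B.Vert,
        q ∈ commonBoundaryZeroSet B.graph lam ∪ (commonZeroSet B.graph lam)ᶜ ↔ q.1 ∈ Xᶜ := fun q => by
      rw [B.commonBoundaryZeroSet_eq hS hX, B.commonZeroSet_eq hS hX]
      constructor
      · rintro (h | h)
        · exact h.1
        · exact (not_not.1 h : IsMissable S X q.1).1
      · intro h
        by_cases hm : IsMissable S X q.1
        · exact Or.inr (not_not.2 hm)
        · exact Or.inl ⟨h, hm⟩
    constructor
    · rintro ⟨q, hq, h⟩
      rw [← hfst _ _ h]
      exact (hmem q).1 hq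
    · exact fun h => ⟨p, (hmem p).2 h, rfl⟩
  let proj : ContractVert B.graph (commonZeroSet B.graph lam) → V :=
    Quotient.lift Sigma.fst fun p q h => hfst p q (Quotient.sound h)
  have hproj : ∀ s : skeletonVerts B.graph lam, proj s ∈ Xᶜ := by
    rintro ⟨s, hs⟩
    induction s using Quotient.inductionOn with
    | h p => exact (hverts p).1 hs
  let F : skeletonVerts B.graph lam → ↥Xᶜ := fun s => ⟨proj s, hproj s⟩
  have hF : Function.Bijective F := by
    constructor
    · rintro ⟨s, hs⟩ ⟨t, ht⟩ h
      have h' : proj s = proj t := congrArg Subtype.val h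
      induction s using Quotient.inductionOn with
      | h p =>
        induction t using Quotient.inductionOn with
        | h q => exact Subtype.ext (hL p q ((hverts p).1 hs) h')
    · rintro ⟨v, hv⟩
      exact ⟨⟨contractMk B.graph _ ⟨v, B.attach v v⟩, (hverts _).2 hv⟩, rfl⟩
  refine ⟨⟨Equiv.ofBijective F hF, ?_⟩, fun p hp => rfl⟩
  rintro ⟨s, hs⟩ ⟨t, ht⟩
  induction s using Quotient.inductionOn with
  | h p =>
    induction t using Quotient.inductionOn with
    | h q => exact (B.contract_adj_iff hfst hL ((hverts p).1 hs) ((hverts q).1 ht)).symm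

lemma exists_metaSkeleton_iso (hS : IsMetaSkeleton S X) (hX : X ≠ Set.univ) :
    ∃ φ : metaSkeleton B.graph lam ≃g S, ∀ p : B.Vert,
      φ (contractMk B.graph (commonBoundaryZeroSet B.graph lam) p) = p.1 := by
  have hmk : ∀ p q : B.Vert, contractMk B.graph (commonBoundaryZeroSet B.graph lam) p =
      contractMk B.graph (commonBoundaryZeroSet B.graph lam) q ↔ p.1 = q.1 := by
    rintro ⟨v, a⟩ ⟨u, b⟩
    -- Here the parts over `X` are contracted too, since only the core is removed.
    rw [B.contractMk_eq_iff (K := {v | ¬ IsCore S X v})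
      (fun u hu v hv h => hv (hS.isCore_of_adj hu h)) fun p => by
        rw [B.commonBoundaryZeroSet_eq hS hX]; rfl]
    constructor
    · rintro (h | h)
      · rw [h]
      · exact h.1
    · intro h
      obtain rfl : v = u := h
      by_cases hv : IsCore S X v
      · have := B.part_of_other v hv.1 hv.2
        exact Or.inl (by rw [Subsingleton.elim a b])
      · exact Or.inr ⟨rfl, hv⟩
  let proj : ContractVert B.graph (commonBoundaryZeroSet B.graph lam) → V :=
    Quotient.lift Sigma.fst fun p q h => (hmk p q).1 (Quotient.sound h)
  have hF : Function.Bijective proj := by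
    constructor
    · intro s t h
      induction s using Quotient.inductionOn with
      | h p =>
        induction t using Quotient.inductionOn with
        | h q => exact (hmk p q).2 h
    · exact fun v => ⟨contractMk B.graph _ ⟨v, B.attach v v⟩, rfl⟩
  refine ⟨⟨Equiv.ofBijective proj hF, ?_⟩, fun p => rfl⟩
  intro s t
  induction s using Quotient.inductionOn with
  | h p =>
    induction t using Quotient.inductionOn with
    | h q =>
      exact (B.contract_adj_iff (L := Set.univ) (fun p q => (hmk p q).1)
        (fun p q _ => (hmk p q).2) trivial trivial).symm

end

end BlowUp

end

end TreeSkeleton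

theorem mainTheorem8 {V : Type u} [Fintype V] (S : SimpleGraph V) (X : Set V) (lam : ℝ)
    (hS : TreeSkeleton.IsMetaSkeleton S X) (hX : X ≠ Set.univ)
    (B : TreeSkeleton.BlowUp.{u, w} S X lam) :
    B.graph.IsTree ∧
    TreeSkeleton.HasEigenvalue B.graph lam ∧
    (∀ M : (S.induce Xᶜ).Subgraph, TreeSkeleton.IsMaximumMatching M →
      TreeSkeleton.multiplicity B.graph lam = M.vertsᶜ.ncard) ∧
    (∃ ψ : TreeSkeleton.skeleton B.graph lam ≃g S.induce Xᶜ,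
      ∀ (p : B.Vert) (hp : TreeSkeleton.contractMk B.graph
          (TreeSkeleton.commonZeroSet B.graph lam) p ∈ TreeSkeleton.skeletonVerts B.graph lam),
        (ψ ⟨_, hp⟩ : V) = p.1) ∧
    (∃ φ : TreeSkeleton.metaSkeleton B.graph lam ≃g S,
      ∀ p : B.Vert, φ (TreeSkeleton.contractMk B.graph
        (TreeSkeleton.commonBoundaryZeroSet B.graph lam) p) = p.1) := by
  obtain ⟨d, hd⟩ := hS.exists_isMissable hX
  refine ⟨B.graph_isTree hS.isTree, ?_, fun M hM => ?_, B.exists_skeleton_iso hS hX,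
    B.exists_metaSkeleton_iso hS hX⟩
  · obtain ⟨x, hx, -⟩ := B.exists_isEigenvector_ne_zero hS (p := ⟨d, B.attach d d⟩) hd
    exact Module.End.hasEigenvalue_of_hasEigenvector hx
  · have h1 := B.multiplicity_add hS hd
    have h2 := hS.ncard_compl_verts_add hM
    omega
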